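/- Let $X$ be a closed (compact, connected) Riemann surface, $L$ a holomorphic line bundle on $X$, and $\alpha\in\mathbb R$. An $L$-twisted $\operatorname{Sp}(2n,\mathbb R)$-Higgs pair on $X$ is a pair $(V,\varphi)$ consisting of a rank $n$ holomorphic vector bundle $V$ on $X$ and a section $\varphi=(\beta,\gamma)\in H^0(L\otimes S^2V\oplus L\otimes S^2V^*)$. *Notation.* For subbundles $W',W''$ of a bundle $W$, $W'\otimes_S W''\subset S^2W$ is the image of $W'\otimes W''$ under the symmetrization map $W\otimes W\to S^2W$, and $W'^{\perp}\subset W^*$ is the annihilator of $W'$. For a filtration by holomorphic subbundles $\mathcal V=(0=V_0\subsetneq V_1\subsetneq\dots\subsetneq V_k=V)$, $k\ge 1$, and real numbers $\lambda=(\lambda_1\le\dots\le\lambda_k)$, put $n_j=\operatorname{rk}V_j$ and $$N(\mathcal V,\lambda)=\sum_{\lambda_i+\lambda_j\le 0}L\otimes V_i\otimes_S V_j\ \oplus\ \sum_{\lambda_i+\lambda_j\ge 0}L\otimes V_{i-1}^{\perp}\otimes_S V_{j-1}^{\perp},$$ $$d(\mathcal V,\lambda,\alpha)=\lambda_k(\deg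 V_k-\alpha n_k)+\sum_{j=1}^{k-1}(\lambda_j-\lambda_{j+1})(\deg V_j-\alpha n_j).$$ The pair $(V,\varphi)$ is $\alpha$-semistable if $d(\mathcal V,\lambda,\alpha)\ge 0$ for all such $\mathcal V$ and $\lambda$ with $\varphi\in H^0(N(\mathcal V,\lambda))$. It is $\alpha$-stable if it is $\alpha$-semistable and moreover $d(\mathcal V,\lambda,\alpha)>0$ for all such $\mathcal V$ and $\lambda$ with $\varphi\in H^0(N(\mathcal V,\lambda))$ for which $\lambda_j<\lambda_{j+1}$ for some $j<k$. **Theorem.** Let $(V,\varphi)$ be an $L$-twisted $\operatorname{Sp}(2n,\mathbb R)$-Higgs pair. Then $(V,\varphi)$ is $\alpha$-stable if and only if the following condition holds. For any holomorphic subbundles $0\subset V_1\subset V_2\subset V$ (inclusions not necessarily strict) such that $$\varphi\in H^0\bigl(L\otimes((S^2V_2+V_1\otimes_S V)\oplus(S^2V_1^{\perp}+V_2^{\perp}\otimes_S V^*))\bigr),$$ writing $n_i=\operatorname{rk}V_i$: if at least one of $V_1,V_2$ is proper (that is, non-zero and different from $V$), then $$\deg V-\deg V_2-\deg V_1>\alpha(n-n_2-n_1),$$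 and in any other case $$\deg V-\deg V_2-\deg V_1\ge\alpha(n-n_2-n_1).$$ -/

import Mathlib

open scoped Manifold ContDiff Topology TensorProduct Bundle
open Bundle

noncomputable section

namespace SpHiggs

section Subbundles

variable {X : Type*} [TopologicalSpace X] [ChartedSpace ℂ X]
  (F : Type*) [NormedAddCommGroup F] [NormedSpace ℂ F]
  (V : X → Type*) [∀ x, AddCommGroup (V x)] [∀ x, Module ℂ (V x)]
  [∀ x, TopologicalSpace (V x)] [TopologicalSpace (TotalSpace F V)]
  [FiberBundle F V]

/-- `s` restricts to a holomorphic section of `V` over `U`. -/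
def IsHolomorphicOn {V : X → Type*} [∀ x, AddCommGroup (V x)] [∀ x, Module ℂ (V x)]
    [∀ x, TopologicalSpace (V x)] [TopologicalSpace (TotalSpace F V)] [FiberBundle F V]
    (s : ∀ x, V x) (U : Set X) : Prop :=
  ContMDiffOn 𝓘(ℂ) (𝓘(ℂ).prod 𝓘(ℂ, F)) ω (fun x => TotalSpace.mk' F x (s x)) U

/-- `e` is a holomorphic frame over `U` of the family of subspaces `W x ⊆ V x`: holomorphic
sections of `V` over `U` that form a basis of `W x` for every `x ∈ U`. -/
structure IsFrameOn {V : X → Type*} [∀ x, AddCommGroup (V x)] [∀ x, Module ℂ (V x)]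
    [∀ x, TopologicalSpace (V x)] [TopologicalSpace (TotalSpace F V)] [FiberBundle F V]
    (W : ∀ x, Submodule ℂ (V x)) {r : ℕ} (e : Fin r → ∀ x, V x) (U : Set X) : Prop where
  holomorphic : ∀ i, IsHolomorphicOn F (e i) U
  linearIndependent : ∀ x ∈ U, LinearIndependent ℂ (fun i => e i x)
  span_eq : ∀ x ∈ U, Submodule.span ℂ (Set.range fun i => e i x) = W x

/-- A holomorphic subbundle of `V`: a family of subspaces of the fibres which locally has a
holomorphic frame (of fixed length). -/
@[ext]
structure HolSubbundle where
  fiber : ∀ x, Submodule ℂ (V x)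
  exists_frame : ∃ r : ℕ, ∀ x₀ : X, ∃ U : Set X, IsOpen U ∧ x₀ ∈ U ∧
    ∃ e : Fin r → ∀ x, V x, IsFrameOn F fiber e U

namespace HolSubbundle

instance : PartialOrder (HolSubbundle F V) :=
  PartialOrder.lift (fun W => W.fiber) fun _ _ h => HolSubbundle.ext h

/-- The zero subbundle. -/
instance : Bot (HolSubbundle F V) where
  bot :=
    { fiber := fun _ => ⊥
      exists_frame := ⟨0, fun _ => ⟨Set.univ, isOpen_univ, trivial, fun i => i.elim0,
        { holomorphic := fun i => i.elim0
          linearIndependent := fun _ _ => linearIndependent_empty_type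
          span_eq := fun x _ => by simp }⟩⟩ }

/-- The whole bundle `V`, as a subbundle of itself. -/
instance [VectorBundle ℂ F V] [ContMDiffVectorBundle ω F V 𝓘(ℂ)] [FiniteDimensional ℂ F] :
    Top (HolSubbundle F V) where
  top :=
    { fiber := fun _ => ⊤
      exists_frame := ⟨Module.finrank ℂ F, fun x₀ => by
        have h := (trivializationAt F V x₀).isLocalFrameOn_localFrame_baseSet
          𝓘(ℂ) ω (Module.finBasis ℂ F)
        exact ⟨_, (trivializationAt F V x₀).open_baseSet,
          FiberBundle.mem_baseSet_trivializationAt' x₀, _,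
          { holomorphic := fun i => h.contMDiffOn i
            linearIndependent := fun x hx => h.linearIndependent hx
            span_eq := fun x hx => top_le_iff.1 (h.generating hx) }⟩⟩ }

variable {F V}

/-- The rank: the dimension of the fibres (which all have the same dimension). -/
def rank [Nonempty X] (W : HolSubbundle F V) : ℕ :=
  Module.finrank ℂ (W.fiber (Classical.arbitrary X))

/-- The integer `d` is the degree of the divisor of a meromorphic section
`σ₁ ∧ ⋯ ∧ σᵣ ≢ 0` of the determinant line bundle `det W`, where `r = rk W`.

Here `σ₁, …, σᵣ` are meromorphic sections of `W`: near each point `x₀`, in a local holomorphic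
frame `e₁, …, eᵣ` of `W`, one has `σⱼ = ∑ᵢ Aᵢⱼ eᵢ` away from `x₀`, with functions `Aᵢⱼ` which are
meromorphic at `x₀`. The divisor has the multiplicity `D x₀ = ord_{x₀} (det A)` at `x₀`. -/
def IsDegree [Nonempty X] (W : HolSubbundle F V) (d : ℤ) : Prop :=
  ∃ (σ : Fin W.rank → ∀ x, V x) (D : X →₀ ℤ),
    (∀ x₀ : X, ∃ (U : Set X) (e : Fin W.rank → ∀ x, V x)
        (A : X → Matrix (Fin W.rank) (Fin W.rank) ℂ),
      IsOpen U ∧ x₀ ∈ U ∧ IsFrameOn F W.fiber e U ∧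
      (∀ x ∈ U, x ≠ x₀ → ∀ j, σ j x = ∑ i, A x i j • e i x) ∧
      (∀ i j, MeromorphicAt (fun z => A ((chartAt ℂ x₀).symm z) i j) (chartAt ℂ x₀ x₀)) ∧
      meromorphicOrderAt (fun z => (A ((chartAt ℂ x₀).symm z)).det) (chartAt ℂ x₀ x₀)
        = ((D x₀ : ℤ) : WithTop ℤ)) ∧
    D.sum (fun _ m => m) = d

open scoped Classical in
/-- The degree of a holomorphic (sub)bundle `W` on a closed Riemann surface: the degree of the
divisor of any nonzero meromorphic section of `det W`. Such sections exist, and their divisors all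
have the same degree, on every closed (compact, connected) Riemann surface. -/
def degree [Nonempty X] (W : HolSubbundle F V) : ℤ :=
  if h : ∃ d, W.IsDegree d then h.choose else 0

/-- A subbundle is proper if it is nonzero and different from `V`. -/
def IsProper [VectorBundle ℂ F V] [ContMDiffVectorBundle ω F V 𝓘(ℂ)] [FiniteDimensional ℂ F]
    (W : HolSubbundle F V) : Prop :=
  W ≠ ⊥ ∧ W ≠ ⊤

end HolSubbundle

end Subbundles

section LinearAlgebra

/-- The product `v · w` in the second symmetric power `S²M` of two elements of `M`. -/
def symMul {M : Type*} [AddCommMonoid M] [Module ℂ M] (v w : M) : Sym[ℂ]^2 M :=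
  SymmetricPower.tprod ℂ ![v, w]

/-- The image `A ⊗_S B ⊆ S²M` of `A ⊗ B` under the symmetrization map `M ⊗ M → S²M`. -/
def symTensor {M : Type*} [AddCommMonoid M] [Module ℂ M] (A B : Submodule ℂ M) :
    Submodule ℂ (Sym[ℂ]^2 M) :=
  Submodule.span ℂ {t | ∃ v ∈ A, ∃ w ∈ B, t = symMul v w}

/-- The subspace `L ⊗ N` of `L ⊗ M`, for a subspace `N ⊆ M`. -/
def twist (L : Type*) [AddCommMonoid L] [Module ℂ L] {M : Type*} [AddCommMonoid M] [Module ℂ M]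
    (N : Submodule ℂ M) : Submodule ℂ (L ⊗[ℂ] M) :=
  LinearMap.range (N.subtype.lTensor L)

/-- The annihilator `Aᗮ ⊆ M^*` of a subspace `A ⊆ M`. -/
def annihilator {M : Type*} [AddCommGroup M] [Module ℂ M] [TopologicalSpace M]
    (A : Submodule ℂ M) : Submodule ℂ (M →L[ℂ] ℂ) where
  carrier := {ξ | ∀ v ∈ A, ξ v = 0}
  add_mem' := fun {ξ η} hξ hη v hv => by simp [hξ v hv, hη v hv]
  zero_mem' := fun v _ => by simp
  smul_mem' := fun c ξ hξ v hv => by simp [hξ v hv]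

end LinearAlgebra

section Pairs

variable {X : Type*} [TopologicalSpace X] [ChartedSpace ℂ X]

/-- The fibres of the dual bundle `V^*`; its holomorphic structure is Mathlib's structure on the
bundle of homomorphisms from `V` to the trivial line bundle. -/
abbrev Dual (V : X → Type*) [∀ x, AddCommGroup (V x)] [∀ x, Module ℂ (V x)]
    [∀ x, TopologicalSpace (V x)] (x : X) : Type _ :=
  V x →L[ℂ] Bundle.Trivial X ℂ x

/-- `s` is a global holomorphic section of `L ⊗ S²E`: locally it is a finite sum of sections
`l ⊗ (u · w)` with `l` a holomorphic section of `L` and `u`, `w` holomorphic sections of `E`. -/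
def IsHolomorphicSymSection
    {L : X → Type*} [∀ x, AddCommGroup (L x)] [∀ x, Module ℂ (L x)]
    [∀ x, TopologicalSpace (L x)] [TopologicalSpace (TotalSpace ℂ L)] [FiberBundle ℂ L]
    (F : Type*) [NormedAddCommGroup F] [NormedSpace ℂ F]
    {E : X → Type*} [∀ x, AddCommGroup (E x)] [∀ x, Module ℂ (E x)]
    [∀ x, TopologicalSpace (E x)] [TopologicalSpace (TotalSpace F E)] [FiberBundle F E]
    (s : ∀ x, L x ⊗[ℂ] Sym[ℂ]^2 (E x)) : Prop :=
  ∀ x₀ : X, ∃ U : Set X, IsOpen U ∧ x₀ ∈ U ∧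
    ∃ (m : ℕ) (l : Fin m → ∀ x, L x) (u w : Fin m → ∀ x, E x),
      (∀ i, IsHolomorphicOn ℂ (l i) U) ∧ (∀ i, IsHolomorphicOn F (u i) U) ∧
      (∀ i, IsHolomorphicOn F (w i) U) ∧
      ∀ x ∈ U, s x = ∑ i, l i x ⊗ₜ[ℂ] symMul (u i x) (w i x)

variable
  (L : X → Type*) [∀ x, AddCommGroup (L x)] [∀ x, Module ℂ (L x)]
  [∀ x, TopologicalSpace (L x)] [TopologicalSpace (TotalSpace ℂ L)] [FiberBundle ℂ L]
  [VectorBundle ℂ ℂ L]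
  (F : Type*) [NormedAddCommGroup F] [NormedSpace ℂ F]
  (V : X → Type*) [∀ x, AddCommGroup (V x)] [∀ x, Module ℂ (V x)]
  [∀ x, TopologicalSpace (V x)] [TopologicalSpace (TotalSpace F V)]
  [FiberBundle F V] [VectorBundle ℂ F V]

/-- A holomorphic section `φ = (β, γ)` of `L ⊗ S²V ⊕ L ⊗ S²V^*`. Together with the bundle `V`, it
is an `L`-twisted `Sp(2n, ℝ)`-Higgs pair, where `n = rk V`. -/
structure HiggsField where
  β : ∀ x, L x ⊗[ℂ] Sym[ℂ]^2 (V x)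
  γ : ∀ x, L x ⊗[ℂ] Sym[ℂ]^2 (Dual V x)
  holomorphic_β : IsHolomorphicSymSection F β
  holomorphic_γ : IsHolomorphicSymSection (F →L[ℂ] ℂ) γ

variable [ContMDiffVectorBundle ω F V 𝓘(ℂ)] [FiniteDimensional ℂ F]

/-- A filtration `0 = V₀ ⊊ V₁ ⊊ ⋯ ⊊ V_{k+1} = V` by holomorphic subbundles, with `k + 1` steps. -/
structure Filtration (k : ℕ) where
  sub : Fin (k + 2) → HolSubbundle F V
  strictMono : StrictMono sub
  sub_zero : sub 0 = ⊥
  sub_last : sub (Fin.last (k + 1)) = ⊤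

variable {L F V}

/-- The part `∑_{λᵢ + λⱼ ≤ 0} Vᵢ ⊗_S Vⱼ` of the fibre at `x` of `N(𝒱, λ)`, before twisting by `L`.
The step with index `i : Fin (k + 1)` runs from `sub i.castSucc` to `sub i.succ`. -/
def Filtration.lower {k : ℕ} (𝒱 : Filtration F V k) (lam : Fin (k + 1) → ℝ) (x : X) :
    Submodule ℂ (Sym[ℂ]^2 (V x)) :=
  ⨆ (i : Fin (k + 1)) (j : Fin (k + 1)) (_ : lam i + lam j ≤ 0),
    symTensor ((𝒱.sub i.succ).fiber x) ((𝒱.sub j.succ).fiber x)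

/-- The part `∑_{λᵢ + λⱼ ≥ 0} Vᵢ₋₁ᗮ ⊗_S Vⱼ₋₁ᗮ` of the fibre at `x` of `N(𝒱, λ)`, before twisting
by `L`. -/
def Filtration.upper {k : ℕ} (𝒱 : Filtration F V k) (lam : Fin (k + 1) → ℝ) (x : X) :
    Submodule ℂ (Sym[ℂ]^2 (Dual V x)) :=
  ⨆ (i : Fin (k + 1)) (j : Fin (k + 1)) (_ : 0 ≤ lam i + lam j),
    symTensor (annihilator ((𝒱.sub i.castSucc).fiber x))
      (annihilator ((𝒱.sub j.castSucc).fiber x))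

/-- `φ ∈ H⁰(N(𝒱, λ))`. -/
def HiggsField.InN (φ : HiggsField L F V) {k : ℕ} (𝒱 : Filtration F V k)
    (lam : Fin (k + 1) → ℝ) : Prop :=
  ∀ x, φ.β x ∈ twist (L x) (𝒱.lower lam x) ∧ φ.γ x ∈ twist (L x) (𝒱.upper lam x)

/-- The number `d(𝒱, λ, α) = λ_k (deg V_k - α n_k) + ∑_{j < k} (λ_j - λ_{j+1}) (deg V_j - α n_j)`
for a filtration with `k` steps (here the number of steps is written as `k + 1`). -/
def Filtration.d [Nonempty X] {k : ℕ} (𝒱 : Filtration F V k) (lam : Fin (k + 1) → ℝ)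
    (α : ℝ) : ℝ :=
  lam (Fin.last k) * ((𝒱.sub (Fin.last k).succ).degree - α * (𝒱.sub (Fin.last k).succ).rank) +
    ∑ j : Fin k, (lam j.castSucc - lam j.succ) *
      ((𝒱.sub j.castSucc.succ).degree - α * (𝒱.sub j.castSucc.succ).rank)

/-- `α`-semistability of the pair `(V, φ)`. -/
def HiggsField.IsSemistable [Nonempty X] (φ : HiggsField L F V) (α : ℝ) : Prop :=
  ∀ (k : ℕ) (𝒱 : Filtration F V k) (lam : Fin (k + 1) → ℝ), Monotone lam →
    φ.InN 𝒱 lam → 0 ≤ 𝒱.d lam α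

/-- `α`-stability of the pair `(V, φ)`. -/
def HiggsField.IsStable [Nonempty X] (φ : HiggsField L F V) (α : ℝ) : Prop :=
  φ.IsSemistable α ∧
    ∀ (k : ℕ) (𝒱 : Filtration F V k) (lam : Fin (k + 1) → ℝ), Monotone lam →
      (∃ j : Fin k, lam j.castSucc < lam j.succ) → φ.InN 𝒱 lam → 0 < 𝒱.d lam α

/-- For subbundles `V₁ ⊆ V₂ ⊆ V`, the condition
`φ ∈ H⁰(L ⊗ ((S²V₂ + V₁ ⊗_S V) ⊕ (S²V₁ᗮ + V₂ᗮ ⊗_S V^*)))`. -/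
def HiggsField.Admissible (φ : HiggsField L F V) (V₁ V₂ : HolSubbundle F V) : Prop :=
  ∀ x,
    φ.β x ∈ twist (L x)
      (symTensor (V₂.fiber x) (V₂.fiber x) ⊔ symTensor (V₁.fiber x) ⊤) ∧
    φ.γ x ∈ twist (L x)
      (symTensor (annihilator (V₁.fiber x)) (annihilator (V₁.fiber x)) ⊔
        symTensor (annihilator (V₂.fiber x)) ⊤)

end Pairs

end SpHiggs

end

namespace SpHiggs

section SymTensor

variable {M : Type*} [AddCommMonoid M] [Module ℂ M]

lemma symMul_comm (v w : M) : symMul v w = symMul w v := by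
  have h := SymmetricPower.tprod_equiv (R := ℂ) (Equiv.swap (0 : Fin 2) 1) ![v, w]
  unfold symMul
  rw [← h]
  congr 1
  ext i
  fin_cases i <;> simp

lemma symTensor_mono {A A' B B' : Submodule ℂ M} (hA : A ≤ A') (hB : B ≤ B') :
    symTensor A B ≤ symTensor A' B' := by
  refine Submodule.span_mono ?_
  rintro t ⟨v, hv, w, hw, rfl⟩
  exact ⟨v, hA hv, w, hB hw, rfl⟩

lemma symTensor_comm (A B : Submodule ℂ M) : symTensor A B = symTensor B A := by
  unfold symTensor
  congr 1
  ext t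
  constructor <;> rintro ⟨v, hv, w, hw, rfl⟩ <;> exact ⟨w, hw, v, hv, symMul_comm _ _⟩

lemma symTensor_bot_left (B : Submodule ℂ M) : symTensor ⊥ B = ⊥ := by
  refine (Submodule.span_eq_bot).2 ?_
  rintro t ⟨v, hv, w, -, rfl⟩
  rw [Submodule.mem_bot] at hv
  exact (SymmetricPower.tprod ℂ).map_coord_zero (m := ![v, w]) 0 (by simp [hv])

lemma twist_mono (L : Type*) [AddCommMonoid L] [Module ℂ L] {N N' : Submodule ℂ M}
    (h : N ≤ N') : twist L N ≤ twist L N' := by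
  unfold twist
  rw [← Submodule.subtype_comp_inclusion N N' h, LinearMap.lTensor_comp]
  exact LinearMap.range_comp_le_range _ _

end SymTensor

section Annihilator

variable {M : Type*} [AddCommGroup M] [Module ℂ M] [TopologicalSpace M]

lemma annihilator_anti {A B : Submodule ℂ M} (h : A ≤ B) : annihilator B ≤ annihilator A :=
  fun _ hξ v hv => hξ v (h hv)

lemma annihilator_bot : annihilator (⊥ : Submodule ℂ M) = ⊤ := by
  refine top_le_iff.1 fun ξ _ v hv => ?_
  rw [Submodule.mem_bot] at hv
  rw [hv, map_zero]

lemma annihilator_top : annihilator (⊤ : Submodule ℂ M) = ⊥ := by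
  refine le_bot_iff.1 fun ξ hξ => ?_
  rw [Submodule.mem_bot]
  ext v
  exact hξ v trivial

end Annihilator

section SignVectors

/-- The vector with entries `-1` at the indices below `a`, `0` at those from `a` to `b`, and `1`
at those from `b` on. -/
noncomputable def signStep {k : ℕ} (a b : Fin (k + 2)) (i : Fin (k + 1)) : ℝ :=
  1 - (if i.castSucc < b then 1 else 0) - (if i.castSucc < a then 1 else 0)

lemma signStep_monotone {k : ℕ} (a b : Fin (k + 2)) : Monotone (signStep a b) := by
  intro i j hij
  have h (c : Fin (k + 2)) : (if j.castSucc < c then (1 : ℝ) else 0)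
      ≤ if i.castSucc < c then 1 else 0 := by
    by_cases hj : j.castSucc < c
    · have hi : i.castSucc < c := lt_of_le_of_lt (Fin.castSucc_le_castSucc_iff.2 hij) hj
      simp [hi, hj]
    · rw [if_neg hj]
      split_ifs <;> norm_num
  unfold signStep
  linarith [h a, h b]

lemma sum_sub_of_castSucc_lt {k : ℕ} (g : Fin (k + 2) → ℝ) (c : Fin (k + 2)) :
    ∑ i : Fin (k + 1), (if i.castSucc < c then (1 : ℝ) else 0) * (g i.succ - g i.castSucc)
      = g c - g 0 := by
  induction c using Fin.induction with
  | zero => simp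
  | succ m ih =>
    have h : ∀ i : Fin (k + 1), (if i.castSucc < m.succ then (1 : ℝ) else 0)
        * (g i.succ - g i.castSucc)
        = (if i.castSucc < m.castSucc then (1 : ℝ) else 0) * (g i.succ - g i.castSucc)
          + if i = m then g i.succ - g i.castSucc else 0 := by
      intro i
      rcases lt_trichotomy i m with h | rfl | h
      · have h1 : i.castSucc < m.succ := Fin.castSucc_lt_succ_iff.2 h.le
        simp [h, h.ne, h1]
      · simp
      · have h1 : ¬ i.castSucc < m.succ := fun h' => absurd (Fin.castSucc_lt_succ_iff.1 h') h.not_ge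
        simp [h.ne', h1, h.not_gt]
    rw [Finset.sum_congr rfl fun i _ => h i, Finset.sum_add_distrib, ih]
    simp

lemma sum_signStep {k : ℕ} (g : Fin (k + 2) → ℝ) (a b : Fin (k + 2)) :
    ∑ i : Fin (k + 1), signStep a b i * (g i.succ - g i.castSucc)
      = g (Fin.last (k + 1)) - g b - g a + g 0 := by
  have h := sum_sub_of_castSucc_lt g (Fin.last (k + 1))
  simp only [Fin.castSucc_lt_last, if_true] at h
  have : ∀ i : Fin (k + 1), signStep a b i * (g i.succ - g i.castSucc)
      = 1 * (g i.succ - g i.castSucc)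
        - (if i.castSucc < b then (1 : ℝ) else 0) * (g i.succ - g i.castSucc)
        - (if i.castSucc < a then (1 : ℝ) else 0) * (g i.succ - g i.castSucc) := by
    intro i
    rw [signStep]
    ring
  rw [Finset.sum_congr rfl fun i _ => this i, Finset.sum_sub_distrib, Finset.sum_sub_distrib, h,
    sum_sub_of_castSucc_lt, sum_sub_of_castSucc_lt]
  ring

lemma sum_by_parts {k : ℕ} (lam : Fin (k + 1) → ℝ) (g : Fin (k + 2) → ℝ) (h0 : g 0 = 0) :
    lam (Fin.last k) * g (Fin.last k).succ
        + ∑ j : Fin k, (lam j.castSucc - lam j.succ) * g j.castSucc.succ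
      = ∑ i : Fin (k + 1), lam i * (g i.succ - g i.castSucc) := by
  have h1 : ∑ i : Fin (k + 1), lam i * g i.succ
      = ∑ j : Fin k, lam j.castSucc * g j.castSucc.succ
        + lam (Fin.last k) * g (Fin.last k).succ := Fin.sum_univ_castSucc _
  have h2 : ∑ i : Fin (k + 1), lam i * g i.castSucc
      = ∑ j : Fin k, lam j.succ * g j.castSucc.succ := by
    rw [Fin.sum_univ_succ]
    simp [h0]
  simp only [mul_sub, sub_mul, Finset.sum_sub_distrib]
  rw [h1, h2]
  ring

/-- The initial segment on which a monotone function satisfies a downward closed condition. -/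
lemma exists_castSucc_lt_iff {k : ℕ} (p : Fin (k + 1) → Prop)
    (hp : ∀ i j, i ≤ j → p j → p i) :
    ∃ c : Fin (k + 2), ∀ i : Fin (k + 1), i.castSucc < c ↔ p i := by
  classical
  by_cases h : ∀ i, p i
  · exact ⟨Fin.last _, fun i => ⟨fun _ => h i, fun _ => Fin.castSucc_lt_last i⟩⟩
  · push Not at h
    obtain ⟨m, hm, hmin⟩ := WellFounded.has_min (wellFounded_lt (α := Fin (k + 1)))
      {i | ¬ p i} h
    refine ⟨m.castSucc, fun i => ?_⟩
    rw [Fin.castSucc_lt_castSucc_iff]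
    constructor
    · intro hi
      by_contra hpi
      exact hmin i hpi hi
    · intro hi
      by_contra hle
      exact hm (hp _ _ (not_lt.1 hle) hi)

lemma exists_sign_eq_signStep {k : ℕ} (lam : Fin (k + 1) → ℝ) (hlam : Monotone lam) :
    ∃ a b : Fin (k + 2), a ≤ b ∧ ∀ i, (SignType.sign (lam i) : ℝ) = signStep a b i := by
  obtain ⟨a, ha⟩ := exists_castSucc_lt_iff (fun i => lam i < 0)
    fun i j hij hj => lt_of_le_of_lt (hlam hij) hj
  obtain ⟨b, hb⟩ := exists_castSucc_lt_iff (fun i => lam i ≤ 0)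
    fun i j hij hj => le_trans (hlam hij) hj
  refine ⟨a, b, ?_, fun i => ?_⟩
  · by_contra! hba
    have hbl : b ≠ Fin.last (k + 1) := (lt_of_lt_of_le hba (Fin.le_last a)).ne
    obtain ⟨m, rfl⟩ := Fin.exists_castSucc_eq.2 hbl
    exact lt_irrefl _ ((hb m).2 ((ha m).1 hba).le)
  · rw [signStep]
    simp only [ha, hb]
    rcases lt_trichotomy (lam i) 0 with h | h | h
    · norm_num [h, h.le]
    · simp [h]
    · simp [h, h.not_ge, h.not_gt]

end SignVectors

section Bundles

variable {X : Type*} [TopologicalSpace X] [ChartedSpace ℂ X]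
  {F : Type*} [NormedAddCommGroup F] [NormedSpace ℂ F]
  {V : X → Type*} [∀ x, AddCommGroup (V x)] [∀ x, Module ℂ (V x)]
  [∀ x, TopologicalSpace (V x)] [TopologicalSpace (TotalSpace F V)]
  [FiberBundle F V]

namespace HolSubbundle

lemma fiber_mono {W W' : HolSubbundle F V} (h : W ≤ W') (x : X) : W.fiber x ≤ W'.fiber x := h x

lemma bot_le' (W : HolSubbundle F V) : ⊥ ≤ W := fun _ => bot_le

lemma rank_bot [Nonempty X] : (⊥ : HolSubbundle F V).rank = 0 :=
  finrank_bot ℂ _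

lemma IsDegree.eq_zero_of_rank_eq_zero [Nonempty X] {W : HolSubbundle F V} {d : ℤ}
    (h : W.IsDegree d) (hW : W.rank = 0) : d = 0 := by
  obtain ⟨σ, D, hD, rfl⟩ := h
  have : IsEmpty (Fin W.rank) := by rw [hW]; infer_instance
  have hD0 : D = 0 := by
    ext x
    obtain ⟨U, e, A, -, -, -, -, -, hord⟩ := hD x
    simp only [Matrix.det_isEmpty, meromorphicOrderAt_const, one_ne_zero, if_false] at hord
    exact_mod_cast hord.symm
  rw [hD0, Finsupp.sum_zero_index]

lemma degree_bot [Nonempty X] : (⊥ : HolSubbundle F V).degree = 0 := by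
  unfold degree
  split_ifs with h
  · exact h.choose_spec.eq_zero_of_rank_eq_zero rank_bot
  · rfl

variable [VectorBundle ℂ F V] [ContMDiffVectorBundle ω F V 𝓘(ℂ)] [FiniteDimensional ℂ F]

lemma le_top' (W : HolSubbundle F V) : W ≤ ⊤ := fun _ => le_top

lemma rank_top [Nonempty X] : (⊤ : HolSubbundle F V).rank = Module.finrank ℂ F := by
  have x : X := Classical.arbitrary X
  refine (finrank_top ℂ _).trans ?_
  exact ((trivializationAt F V _).continuousLinearEquivAt ℂ _
    (FiberBundle.mem_baseSet_trivializationAt' _)).toLinearEquiv.finrank_eq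

end HolSubbundle

variable [VectorBundle ℂ F V] [ContMDiffVectorBundle ω F V 𝓘(ℂ)] [FiniteDimensional ℂ F]

namespace Filtration

/-- The trivial filtration `0 ⊊ V`. -/
def trivial (h : (⊥ : HolSubbundle F V) < ⊤) : Filtration F V 0 where
  sub := ![⊥, ⊤]
  strictMono := by
    rw [Fin.strictMono_iff_lt_succ]
    intro i
    fin_cases i
    exact h
  sub_zero := rfl
  sub_last := rfl

/-- The filtration `0 ⊊ W ⊊ V`. -/
def ofLT (W : HolSubbundle F V) (h₀ : ⊥ < W) (h₁ : W < ⊤) : Filtration F V 1 where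
  sub := ![⊥, W, ⊤]
  strictMono := by
    rw [Fin.strictMono_iff_lt_succ]
    intro i
    fin_cases i
    exacts [h₀, h₁]
  sub_zero := rfl
  sub_last := rfl

/-- The filtration `0 ⊊ V₁ ⊊ V₂ ⊊ V`. -/
def ofLTLT (V₁ V₂ : HolSubbundle F V) (h₀ : ⊥ < V₁) (h : V₁ < V₂) (h₁ : V₂ < ⊤) :
    Filtration F V 2 where
  sub := ![⊥, V₁, V₂, ⊤]
  strictMono := by
    rw [Fin.strictMono_iff_lt_succ]
    intro i
    fin_cases i
    exacts [h₀, h, h₁]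
  sub_zero := rfl
  sub_last := rfl

/-- Any pair `V₁ ⊆ V₂` of subbundles of a nonzero bundle occurs in a filtration. -/
lemma exists_sub_eq (hV : (⊥ : HolSubbundle F V) ≠ ⊤) {V₁ V₂ : HolSubbundle F V} (h : V₁ ≤ V₂) :
    ∃ (k : ℕ) (𝒱 : Filtration F V k) (a b : Fin (k + 2)), a ≤ b ∧ 𝒱.sub a = V₁ ∧ 𝒱.sub b = V₂ := by
  have hbot (W : HolSubbundle F V) (hW : W ≠ ⊥) : ⊥ < W := lt_of_le_of_ne W.bot_le' hW.symm
  have htop (W : HolSubbundle F V) (hW : W ≠ ⊤) : W < ⊤ := lt_of_le_of_ne W.le_top' hW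
  have htriv := hbot ⊤ hV.symm
  by_cases h1 : V₁ = ⊥
  · subst h1
    by_cases h2 : V₂ = ⊥
    · exact ⟨0, trivial htriv, 0, 0, le_rfl, rfl, h2.symm⟩
    by_cases h3 : V₂ = ⊤
    · exact ⟨0, trivial htriv, 0, 1, Fin.zero_le _, rfl, h3.symm⟩
    · exact ⟨1, ofLT V₂ (hbot _ h2) (htop _ h3), 0, 1, Fin.zero_le _, rfl, rfl⟩
  have h2 : V₂ ≠ ⊥ := fun h' => h1 (le_antisymm (h' ▸ h) V₁.bot_le')
  by_cases h3 : V₂ = ⊤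
  · subst h3
    by_cases h4 : V₁ = ⊤
    · exact ⟨0, trivial htriv, 1, 1, le_rfl, h4.symm, rfl⟩
    · exact ⟨1, ofLT V₁ (hbot _ h1) (htop _ h4), 1, 2, Fin.le_last _, rfl, rfl⟩
  by_cases h4 : V₁ = V₂
  · subst h4
    exact ⟨1, ofLT V₁ (hbot _ h1) (htop _ h3), 1, 1, le_rfl, rfl, rfl⟩
  · exact ⟨2, ofLTLT V₁ V₂ (hbot _ h1) (lt_of_le_of_ne h h4) (htop _ h3), 1, 2, by decide, rfl, rfl⟩

variable {k : ℕ} (𝒱 : Filtration F V k)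

/-- The function `j ↦ deg V_j - α n_j`. -/
noncomputable def slope [Nonempty X] (α : ℝ) (j : Fin (k + 2)) : ℝ :=
  (𝒱.sub j).degree - α * (𝒱.sub j).rank

lemma slope_zero [Nonempty X] (α : ℝ) : 𝒱.slope α 0 = 0 := by
  simp [slope, 𝒱.sub_zero, HolSubbundle.degree_bot, HolSubbundle.rank_bot]

lemma d_eq_sum [Nonempty X] (lam : Fin (k + 1) → ℝ) (α : ℝ) :
    𝒱.d lam α = ∑ i, lam i * (𝒱.slope α i.succ - 𝒱.slope α i.castSucc) :=
  sum_by_parts lam (𝒱.slope α) (𝒱.slope_zero α)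

lemma d_signStep [Nonempty X] (a b : Fin (k + 2)) (α : ℝ) :
    𝒱.d (signStep a b) α =
      ((⊤ : HolSubbundle F V).degree - (𝒱.sub b).degree - (𝒱.sub a).degree : ℝ)
        - α * ((Module.finrank ℂ F : ℝ) - (𝒱.sub b).rank - (𝒱.sub a).rank) := by
  rw [d_eq_sum, sum_signStep, slope_zero]
  simp only [slope, 𝒱.sub_last, HolSubbundle.rank_top]
  ring

lemma d_sub_smul [Nonempty X] (lam μ : Fin (k + 1) → ℝ) (t α : ℝ) :
    𝒱.d lam α = 𝒱.d (fun i => lam i - t * μ i) α + t * 𝒱.d μ α := by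
  simp only [d_eq_sum, Finset.mul_sum, ← Finset.sum_add_distrib]
  exact Finset.sum_congr rfl fun i _ => by ring

lemma lower_mono {lam μ : Fin (k + 1) → ℝ} (h : ∀ i j, lam i + lam j ≤ 0 → μ i + μ j ≤ 0) (x : X) :
    𝒱.lower lam x ≤ 𝒱.lower μ x :=
  iSup_mono fun i => iSup_mono fun j => iSup_mono' fun hij => ⟨h i j hij, le_rfl⟩

lemma upper_mono {lam μ : Fin (k + 1) → ℝ} (h : ∀ i j, 0 ≤ lam i + lam j → 0 ≤ μ i + μ j) (x : X) :
    𝒱.upper lam x ≤ 𝒱.upper μ x :=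
  iSup_mono fun i => iSup_mono fun j => iSup_mono' fun hij => ⟨h i j hij, le_rfl⟩

lemma symTensor_le_lower {lam : Fin (k + 1) → ℝ} {i j : Fin (k + 1)} (h : lam i + lam j ≤ 0)
    (x : X) :
    symTensor ((𝒱.sub i.succ).fiber x) ((𝒱.sub j.succ).fiber x) ≤ 𝒱.lower lam x :=
  le_iSup_of_le i (le_iSup_of_le j (le_iSup_of_le h le_rfl))

lemma symTensor_le_upper {lam : Fin (k + 1) → ℝ} {i j : Fin (k + 1)} (h : 0 ≤ lam i + lam j)
    (x : X) :
    symTensor (annihilator ((𝒱.sub i.castSucc).fiber x))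
      (annihilator ((𝒱.sub j.castSucc).fiber x)) ≤ 𝒱.upper lam x :=
  le_iSup_of_le i (le_iSup_of_le j (le_iSup_of_le h le_rfl))

lemma lower_signStep {a b : Fin (k + 2)} (hab : a ≤ b) (x : X) :
    𝒱.lower (signStep a b) x =
      symTensor ((𝒱.sub b).fiber x) ((𝒱.sub b).fiber x)
        ⊔ symTensor ((𝒱.sub a).fiber x) ⊤ := by
  apply le_antisymm
  · refine iSup_le fun i => iSup_le fun j => iSup_le fun hij => ?_
    have key (i c : Fin (k + 2)) (hi : i ≤ c) : (𝒱.sub i).fiber x ≤ (𝒱.sub c).fiber x :=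
      HolSubbundle.fiber_mono (𝒱.strictMono.monotone hi) x
    by_cases hi : i.castSucc < a
    · exact le_sup_of_le_right
        (symTensor_mono (key _ _ (Fin.castSucc_lt_iff_succ_le.1 hi)) le_top)
    by_cases hj : j.castSucc < a
    · rw [symTensor_comm]
      exact le_sup_of_le_right
        (symTensor_mono (key _ _ (Fin.castSucc_lt_iff_succ_le.1 hj)) le_top)
    have hib : i.castSucc < b ∧ j.castSucc < b := by
      by_contra! h
      simp only [signStep, hi, hj, if_false] at hij
      by_cases hi' : i.castSucc < b
      · have hj' := (h hi').not_gt
        norm_num [hi', hj'] at hij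
      · simp only [hi', if_false] at hij
        split_ifs at hij <;> norm_num at hij
    exact le_sup_of_le_left (symTensor_mono (key _ _ (Fin.castSucc_lt_iff_succ_le.1 hib.1))
      (key _ _ (Fin.castSucc_lt_iff_succ_le.1 hib.2)))
  · refine sup_le ?_ ?_
    · rcases Fin.eq_zero_or_eq_succ b with rfl | ⟨i, rfl⟩
      · rw [𝒱.sub_zero]
        exact (symTensor_bot_left _).trans_le bot_le
      · refine 𝒱.symTensor_le_lower ?_ x
        simp only [signStep, Fin.castSucc_lt_succ, if_true]
        split_ifs <;> norm_num
    · rcases Fin.eq_zero_or_eq_succ a with rfl | ⟨i, rfl⟩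
      · rw [𝒱.sub_zero]
        exact (symTensor_bot_left _).trans_le bot_le
      · have h : symTensor ((𝒱.sub i.succ).fiber x) ⊤
            = symTensor ((𝒱.sub i.succ).fiber x) ((𝒱.sub (Fin.last k).succ).fiber x) := by
          rw [Fin.succ_last, 𝒱.sub_last]
          rfl
        rw [h]
        refine 𝒱.symTensor_le_lower ?_ x
        have hi : i.castSucc < b := lt_of_lt_of_le Fin.castSucc_lt_succ hab
        simp only [signStep, Fin.castSucc_lt_succ, hi, if_true]
        split_ifs <;> norm_num

lemma upper_signStep {a b : Fin (k + 2)} (hab : a ≤ b) (x : X) :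
    𝒱.upper (signStep a b) x =
      symTensor (annihilator ((𝒱.sub a).fiber x)) (annihilator ((𝒱.sub a).fiber x))
        ⊔ symTensor (annihilator ((𝒱.sub b).fiber x)) ⊤ := by
  apply le_antisymm
  · refine iSup_le fun i => iSup_le fun j => iSup_le fun hij => ?_
    have key (c : Fin (k + 2)) (i : Fin (k + 1)) (hi : ¬ i.castSucc < c) :
        annihilator ((𝒱.sub i.castSucc).fiber x) ≤ annihilator ((𝒱.sub c).fiber x) :=
      annihilator_anti (HolSubbundle.fiber_mono (𝒱.strictMono.monotone (not_lt.1 hi)) x)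
    by_cases hi : i.castSucc < b
    swap
    · exact le_sup_of_le_right (symTensor_mono (key _ _ hi) le_top)
    by_cases hj : j.castSucc < b
    swap
    · rw [symTensor_comm]
      exact le_sup_of_le_right (symTensor_mono (key _ _ hj) le_top)
    have hia : ¬ i.castSucc < a ∧ ¬ j.castSucc < a := by
      by_contra h
      rw [not_and_or, not_not, not_not] at h
      simp only [signStep, hi, hj, if_true] at hij
      rcases h with h | h <;> rw [if_pos h] at hij <;> split_ifs at hij <;> norm_num at hij
    exact le_sup_of_le_left (symTensor_mono (key _ _ hia.1) (key _ _ hia.2))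
  · refine sup_le ?_ ?_
    · rcases Fin.eq_castSucc_or_eq_last a with ⟨i, rfl⟩ | rfl
      · refine 𝒱.symTensor_le_upper ?_ x
        simp only [signStep, lt_irrefl, if_false]
        split_ifs <;> norm_num
      · have h : annihilator ((𝒱.sub (Fin.last (k + 1))).fiber x) = ⊥ := by
          rw [𝒱.sub_last]
          exact annihilator_top
        rw [h]
        exact (symTensor_bot_left _).trans_le bot_le
    · rcases Fin.eq_castSucc_or_eq_last b with ⟨i, rfl⟩ | rfl
      · have h : annihilator ((𝒱.sub (Fin.castSucc 0)).fiber x) = ⊤ := by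
          rw [Fin.castSucc_zero, 𝒱.sub_zero]
          exact annihilator_bot
        rw [← h]
        refine 𝒱.symTensor_le_upper ?_ x
        have hi : ¬ i.castSucc < a := hab.not_gt
        simp only [signStep, lt_irrefl, hi, if_false]
        split_ifs <;> norm_num
      · have h : annihilator ((𝒱.sub (Fin.last (k + 1))).fiber x) = ⊥ := by
          rw [𝒱.sub_last]
          exact annihilator_top
        rw [h]
        exact (symTensor_bot_left _).trans_le bot_le

lemma isProper_sub_iff (c : Fin (k + 2)) :
    (𝒱.sub c).IsProper ↔ c ≠ 0 ∧ c ≠ Fin.last (k + 1) := by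
  rw [HolSubbundle.IsProper, ← 𝒱.sub_zero, ← 𝒱.sub_last, 𝒱.strictMono.injective.ne_iff,
    𝒱.strictMono.injective.ne_iff]

end Filtration

lemma signStep_const_iff {k : ℕ} {a b : Fin (k + 2)} :
    (∀ i j : Fin (k + 1), signStep a b i = signStep a b j) ↔
      ¬ ((a ≠ 0 ∧ a ≠ Fin.last (k + 1)) ∨ (b ≠ 0 ∧ b ≠ Fin.last (k + 1))) := by
  have h0 (c : Fin (k + 2)) : (0 : Fin (k + 1)).castSucc < c ↔ c ≠ 0 := by
    rw [Fin.castSucc_zero, Fin.pos_iff_ne_zero]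
  have hl (c : Fin (k + 2)) : (Fin.last k).castSucc < c ↔ c = Fin.last (k + 1) := by
    rw [Fin.castSucc_lt_iff_succ_le, Fin.succ_last, Fin.last_le_iff]
  have h0l : (0 : Fin (k + 2)) ≠ Fin.last (k + 1) := (Fin.last_pos).ne
  constructor
  · intro h
    have := h 0 (Fin.last k)
    simp only [signStep, h0, hl] at this
    by_cases ha : a = 0 <;> by_cases ha' : a = Fin.last (k + 1) <;>
      by_cases hb : b = 0 <;> by_cases hb' : b = Fin.last (k + 1) <;>
      simp_all
    all_goals norm_num at this
  · intro h
    have hc (c : Fin (k + 2)) (hc : c = 0 ∨ c = Fin.last (k + 1)) (i j : Fin (k + 1)) :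
        i.castSucc < c ↔ j.castSucc < c := by
      rcases hc with rfl | rfl
      · simp
      · simp [Fin.castSucc_lt_last]
    intro i j
    simp only [signStep, hc a (by tauto) i j, hc b (by tauto) i j]

lemma exists_lt_succ_iff_of_monotone {k : ℕ} {f : Fin (k + 1) → ℝ} (hf : Monotone f) :
    (∃ j : Fin k, f j.castSucc < f j.succ) ↔ ¬ ∀ i j, f i = f j := by
  constructor
  · rintro ⟨j, hj⟩ h
    exact hj.ne (h _ _)
  · intro h
    by_contra! h'
    have key : ∀ i : Fin (k + 1), f i = f 0 := by
      intro i
      induction i using Fin.induction with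
      | zero => rfl
      | succ m ih => exact (le_antisymm (h' m) (hf Fin.castSucc_lt_succ.le)).trans ih
    exact h fun i j => (key i).trans (key j).symm

section Pairs

variable {L : X → Type*} [∀ x, AddCommGroup (L x)] [∀ x, Module ℂ (L x)]
  [∀ x, TopologicalSpace (L x)] [TopologicalSpace (TotalSpace ℂ L)] [FiberBundle ℂ L]

namespace HiggsField

variable {φ : HiggsField L F V} {k : ℕ} {𝒱 : Filtration F V k}

lemma InN.mono {lam μ : Fin (k + 1) → ℝ} (h : φ.InN 𝒱 lam)
    (hle : ∀ i j, lam i + lam j ≤ 0 → μ i + μ j ≤ 0)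
    (hge : ∀ i j, 0 ≤ lam i + lam j → 0 ≤ μ i + μ j) : φ.InN 𝒱 μ :=
  fun x => ⟨twist_mono _ (𝒱.lower_mono hle x) (h x).1, twist_mono _ (𝒱.upper_mono hge x) (h x).2⟩

/-- Membership in `N` passes to the image of the weights under an odd monotone function. -/
lemma InN.comp_odd {lam : Fin (k + 1) → ℝ} (h : φ.InN 𝒱 lam) {f : ℝ → ℝ} (hf : Monotone f)
    (hodd : ∀ t, f (-t) = - f t) : φ.InN 𝒱 (fun i => f (lam i)) := by
  refine h.mono (fun i j hij => ?_) (fun i j hij => ?_)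
  · have := hf (show lam i ≤ -lam j by linarith)
    rw [hodd] at this
    linarith
  · have := hf (show -lam j ≤ lam i by linarith)
    rw [hodd] at this
    linarith

lemma inN_signStep_iff {a b : Fin (k + 2)} (hab : a ≤ b) :
    φ.InN 𝒱 (signStep a b) ↔ φ.Admissible (𝒱.sub a) (𝒱.sub b) :=
  forall_congr' fun x => by rw [𝒱.lower_signStep hab, 𝒱.upper_signStep hab]

end HiggsField

end Pairs

end Bundles

section Weights

/-- The monotone odd function which moves every number towards `0` by at most `t`. -/
noncomputable def shrink (t x : ℝ) : ℝ := max (x - t) 0 + min (x + t) 0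

lemma shrink_monotone (t : ℝ) : Monotone (shrink t) := by
  intro x y h
  unfold shrink
  gcongr

lemma shrink_neg (t x : ℝ) : shrink t (-x) = - shrink t x := by
  have h1 : max (-x - t) 0 = - min (x + t) 0 := by
    rw [← max_neg_neg]
    congr 1 <;> ring
  have h2 : min (-x + t) 0 = - max (x - t) 0 := by
    rw [← min_neg_neg]
    congr 1 <;> ring
  rw [shrink, shrink, h1, h2]
  ring

lemma shrink_eq {t x : ℝ} (ht : 0 ≤ t) (hx : x = 0 ∨ t ≤ |x|) :
    shrink t x = x - t * (SignType.sign x : ℝ) := by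
  unfold shrink
  rcases lt_trichotomy x 0 with h | rfl | h
  · have : t ≤ -x := by
      rcases hx with hx | hx
      · exact absurd hx h.ne
      · rwa [abs_of_neg h] at hx
    rw [max_eq_right (by linarith), min_eq_left (by linarith)]
    simp [h]
  · simp [ht]
  · have : t ≤ x := by
      rcases hx with hx | hx
      · exact absurd hx h.ne'
      · rwa [abs_of_pos h] at hx
    rw [max_eq_left (by linarith), min_eq_right (by linarith)]
    simp [h]

lemma sign_real_monotone : Monotone fun x : ℝ => (SignType.sign x : ℝ) := by
  intro x y h
  rcases lt_trichotomy x 0 with hx | rfl | hx <;> rcases lt_trichotomy y 0 with hy | rfl | hy <;>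
    first
      | (exfalso; linarith)
      | norm_num [*]

lemma sign_real_neg (x : ℝ) : ((SignType.sign (-x) : SignType) : ℝ) = - (SignType.sign x : ℝ) := by
  rw [Left.sign_neg]
  exact SignType.coe_neg _

end Weights

section Stability

variable {X : Type*} [TopologicalSpace X] [ChartedSpace ℂ X] [Nonempty X]
  {F : Type*} [NormedAddCommGroup F] [NormedSpace ℂ F]
  {V : X → Type*} [∀ x, AddCommGroup (V x)] [∀ x, Module ℂ (V x)]
  [∀ x, TopologicalSpace (V x)] [TopologicalSpace (TotalSpace F V)]
  [FiberBundle F V] [VectorBundle ℂ F V] [ContMDiffVectorBundle ω F V 𝓘(ℂ)]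
  [FiniteDimensional ℂ F]
  {L : X → Type*} [∀ x, AddCommGroup (L x)] [∀ x, Module ℂ (L x)]
  [∀ x, TopologicalSpace (L x)] [TopologicalSpace (TotalSpace ℂ L)] [FiberBundle ℂ L]

/-- Nonnegativity (positivity, for nonconstant weights) of `d` follows from the case of weights in
`{-1, 0, 1}`. -/
lemma Filtration.d_nonneg_of_signStep {φ : HiggsField L F V} {α : ℝ} {k : ℕ}
    {𝒱 : Filtration F V k}
    (h : ∀ a b : Fin (k + 2), a ≤ b → φ.InN 𝒱 (signStep a b) → 0 ≤ 𝒱.d (signStep a b) α ∧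
      ((¬ ∀ i j, signStep a b i = signStep a b j) → 0 < 𝒱.d (signStep a b) α))
    (lam : Fin (k + 1) → ℝ) (hlam : Monotone lam) (hN : φ.InN 𝒱 lam) :
    0 ≤ 𝒱.d lam α ∧ ((¬ ∀ i j, lam i = lam j) → 0 < 𝒱.d lam α) := by
  classical
  induction hm : (Finset.univ.filter fun i => lam i ≠ 0).card using Nat.strong_induction_on
    generalizing lam with
  | _ m ih =>
    subst hm
    by_cases hne : (Finset.univ.filter fun i => lam i ≠ 0).Nonempty
    swap
    · have h0 : ∀ i, lam i = 0 := by
        simpa [Finset.filter_eq_empty_iff] using Finset.not_nonempty_iff_eq_empty.1 hne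
      exact ⟨by simp [Filtration.d_eq_sum, h0], fun hc => absurd (fun i j => by simp [h0]) hc⟩
    obtain ⟨i₀, hi₀, hmin⟩ := Finset.exists_min_image _ (fun i => |lam i|) hne
    have hi₀' : lam i₀ ≠ 0 := by simpa using hi₀
    set t := |lam i₀| with ht
    have htpos : 0 < t := abs_pos.2 hi₀'
    obtain ⟨a, b, hab, hs⟩ := exists_sign_eq_signStep lam hlam
    have hshr : ∀ i, shrink t (lam i) = lam i - t * signStep a b i := by
      intro i
      rw [← hs]
      refine shrink_eq htpos.le ?_
      by_cases h0 : lam i = 0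
      · exact Or.inl h0
      · exact Or.inr (hmin i (by simpa using h0))
    have hNs : φ.InN 𝒱 (signStep a b) := by
      have := hN.comp_odd sign_real_monotone sign_real_neg
      simpa only [hs] using this
    have hlt : (Finset.univ.filter fun i => shrink t (lam i) ≠ 0).card
        < (Finset.univ.filter fun i => lam i ≠ 0).card := by
      refine Finset.card_lt_card ((Finset.ssubset_iff_of_subset ?_).2 ⟨i₀, hi₀, ?_⟩)
      · intro i
        simp only [Finset.mem_filter, Finset.mem_univ, true_and]
        intro h1 h2
        exact h1 (by simp [shrink, h2, htpos.le])
      · simp only [Finset.mem_filter, Finset.mem_univ, true_and, not_not]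
        rw [shrink_eq htpos.le (Or.inr le_rfl), ht, mul_comm, sign_mul_abs, sub_self]
    obtain ⟨ih1, ih2⟩ := ih _ hlt (fun i => shrink t (lam i)) ((shrink_monotone t).comp hlam)
      (hN.comp_odd (shrink_monotone t) (shrink_neg t)) rfl
    obtain ⟨hs1, hs2⟩ := h a b hab hNs
    have hd := 𝒱.d_sub_smul lam (signStep a b) t α
    simp only [← hshr] at hd
    refine ⟨by rw [hd]; positivity, fun hc => ?_⟩
    rw [hd]
    by_cases hcs : ∀ i j, signStep a b i = signStep a b j
    · refine add_pos_of_pos_of_nonneg (ih2 fun hc' => hc fun i j => ?_) (by positivity)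
      have := hc' i j
      rw [hshr, hshr, hcs i j] at this
      linarith
    · exact add_pos_of_nonneg_of_pos ih1 (mul_pos htpos (hs2 hcs))

/-- `α`-stability can be tested on pairs of subbundles `V₁ ⊆ V₂`. -/
theorem HiggsField.isStable_iff (φ : HiggsField L F V) (α : ℝ) :
    φ.IsStable α ↔
      ∀ V₁ V₂ : HolSubbundle F V, V₁ ≤ V₂ → φ.Admissible V₁ V₂ →
        (V₁.IsProper ∨ V₂.IsProper →
          ((⊤ : HolSubbundle F V).degree : ℝ) - V₂.degree - V₁.degree
            > α * ((Module.finrank ℂ F : ℝ) - V₂.rank - V₁.rank)) ∧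
        (¬ (V₁.IsProper ∨ V₂.IsProper) →
          ((⊤ : HolSubbundle F V).degree : ℝ) - V₂.degree - V₁.degree
            ≥ α * ((Module.finrank ℂ F : ℝ) - V₂.rank - V₁.rank)) := by
  have hproper {k : ℕ} (𝒱 : Filtration F V k) (a b : Fin (k + 2)) :
      (𝒱.sub a).IsProper ∨ (𝒱.sub b).IsProper ↔ ¬ ∀ i j, signStep a b i = signStep a b j := by
    rw [signStep_const_iff, not_not, 𝒱.isProper_sub_iff, 𝒱.isProper_sub_iff]
  constructor
  · rintro ⟨hss, hst⟩ V₁ V₂ h12 hadm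
    by_cases hV : (⊥ : HolSubbundle F V) = ⊤
    · have h2 : V₂ = ⊤ := le_antisymm V₂.le_top' (hV ▸ V₂.bot_le')
      have h1 : V₁ = ⊤ := le_antisymm V₁.le_top' (hV ▸ V₁.bot_le')
      have hr : Module.finrank ℂ F = 0 := by
        rw [← HolSubbundle.rank_top (F := F) (V := V), ← hV, HolSubbundle.rank_bot]
      subst h1 h2
      refine ⟨fun h => absurd rfl (h.elim (·.2) (·.2)), fun _ => ?_⟩
      rw [hr, ← hV, HolSubbundle.degree_bot, HolSubbundle.rank_bot]
      simp
    · obtain ⟨k, 𝒱, a, b, hab, rfl, rfl⟩ := Filtration.exists_sub_eq hV h12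
      have hN := (HiggsField.inN_signStep_iff hab).2 hadm
      have hmono := signStep_monotone a b
      refine ⟨fun hp => ?_, fun _ => ?_⟩
      · have := hst k 𝒱 _ hmono
          ((exists_lt_succ_iff_of_monotone hmono).2 ((hproper 𝒱 a b).1 hp)) hN
        rw [𝒱.d_signStep] at this
        exact sub_pos.1 this
      · have := hss k 𝒱 _ hmono hN
        rw [𝒱.d_signStep] at this
        exact sub_nonneg.1 this
  · intro h
    have key (k : ℕ) (𝒱 : Filtration F V k) := Filtration.d_nonneg_of_signStep (φ := φ) (α := α)
      (𝒱 := 𝒱) fun a b hab hN => by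
        obtain ⟨h1, h2⟩ := h _ _ (𝒱.strictMono.monotone hab)
          ((HiggsField.inN_signStep_iff hab).1 hN)
        rw [hproper, gt_iff_lt, ← sub_pos, ← 𝒱.d_signStep] at h1
        rw [hproper, ge_iff_le, ← sub_nonneg, ← 𝒱.d_signStep] at h2
        refine ⟨?_, h1⟩
        by_cases hc : ∀ i j, signStep a b i = signStep a b j
        · exact h2 (not_not.2 hc)
        · exact (h1 hc).le
    exact ⟨fun k 𝒱 lam hlam hN => (key k 𝒱 lam hlam hN).1, fun k 𝒱 lam hlam hlt hN =>
      (key k 𝒱 lam hlam hN).2 ((exists_lt_succ_iff_of_monotone hlam).1 hlt)⟩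

end Stability

end SpHiggs

theorem mainTheorem8
    -- a closed Riemann surface
    (X : Type*) [TopologicalSpace X] [T2Space X] [CompactSpace X] [ConnectedSpace X]
    [ChartedSpace ℂ X] [IsManifold 𝓘(ℂ) ω X]
    -- a holomorphic line bundle
    (L : X → Type*) [∀ x, AddCommGroup (L x)] [∀ x, Module ℂ (L x)]
    [∀ x, TopologicalSpace (L x)] [TopologicalSpace (TotalSpace ℂ L)]
    [FiberBundle ℂ L] [VectorBundle ℂ ℂ L] [ContMDiffVectorBundle ω ℂ L 𝓘(ℂ)]
    -- a holomorphic vector bundle of rank `n`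
    (n : ℕ)
    (V : X → Type*) [∀ x, AddCommGroup (V x)] [∀ x, Module ℂ (V x)]
    [∀ x, TopologicalSpace (V x)] [TopologicalSpace (TotalSpace (Fin n → ℂ) V)]
    [FiberBundle (Fin n → ℂ) V] [VectorBundle ℂ (Fin n → ℂ) V]
    [ContMDiffVectorBundle ω (Fin n → ℂ) V 𝓘(ℂ)]
    -- `φ = (β, γ)`, a holomorphic section of `L ⊗ S²V ⊕ L ⊗ S²V^*`
    (φ : SpHiggs.HiggsField L (Fin n → ℂ) V) (α : ℝ) :
    φ.IsStable α ↔
      ∀ V₁ V₂ : SpHiggs.HolSubbundle (Fin n → ℂ) V, V₁ ≤ V₂ → φ.Admissible V₁ V₂ →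
        (V₁.IsProper ∨ V₂.IsProper →
          ((⊤ : SpHiggs.HolSubbundle (Fin n → ℂ) V).degree : ℝ) - V₂.degree - V₁.degree
            > α * ((n : ℝ) - V₂.rank - V₁.rank)) ∧
        (¬ (V₁.IsProper ∨ V₂.IsProper) →
          ((⊤ : SpHiggs.HolSubbundle (Fin n → ℂ) V).degree : ℝ) - V₂.degree - V₁.degree
            ≥ α * ((n : ℝ) - V₂.rank - V₁.rank)) := by
  simpa only [Module.finrank_fin_fun] using φ.isStable_iff α
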